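/- Corollary (Recurrence Property). Let $\mathbb{H}\subset\mathbb{R}^2$ be the set of sites of the honeycomb lattice made of regular hexagons of side length $1$, placed so that $(0,0)$ and $(1,0)$ are neighbouring sites. Given an initial configuration $C(0,\cdot):\mathbb{H}\to\{-1,1\}$, where $1$ denotes a right scatterer and $-1$ a left scatterer, a particle starts at $\mathbf{r}(0)=(0,0)$ with velocity $\mathbf{v}(0)=(1,0)$ and moves, for $t=0,1,2,\dots$, according to $$\mathbf{r}(t+1)=\mathbf{r}(t)+\mathbf{v}(t),\qquad \mathbf{v}(t+1)=R[C(t,\mathbf{r}(t+1))]\,\mathbf{v}(t),$$ $$C(t+1,\mathbf{h})=\begin{cases}-C(t,\mathbf{h}) & \text{if } \mathbf{h}=\mathbf{r}(t+1),\\ C(t,\mathbf{h}) & \text{otherwise,}\end{cases}\qquad R[z]=\begin{pmatrix}\cos(\frac{\pi}{3}z)&\sin(\frac{\pi}{3}z)\\-\sin(\frac{\pi}{3}z)&\cos(\frac{\pi}{3}z)\end{pmatrix}.$$ Let $p\in[0,1]$, and let the initial orientations $C(0,\mathbf{h})$, $\mathbf{h}\in\mathbb{H}$, be independent random variables with $\mathbb{P}[C(0,\mathbf{h})=1]=p$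 for every $\mathbf{h}\in\mathbb{H}$ (the $(H;p)$ model). Then, with probability $1$, the particle returns to its initial position infinitely often, that is, $\mathbf{r}(t)=\mathbf{r}(0)$ for infinitely many times $t$. -/

import Mathlib

/-- The Euclidean plane. -/
abbrev Plane : Type := EuclideanSpace ℝ (Fin 2)

namespace FlippingRotator

noncomputable section

/-- The point `m a₁ + n a₂`, where `a₁ = (3/2, √3/2)` and `a₂ = (3/2, -√3/2)` generate the
translations of the honeycomb lattice with hexagons of side length one. -/
def translation (m n : ℤ) : Plane :=
  !₂[(3 / 2 : ℝ) * (m + n), √3 / 2 * (m - n)]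

/-- The sites of the honeycomb lattice with bonds of unit length that has `(0, 0)` and `(1, 0)` as
neighbouring sites: the translates of these two points. -/
def sites : Set Plane :=
  {x | ∃ m n : ℤ, x = translation m n ∨ x = !₂[(1 : ℝ), 0] + translation m n}

/-- The orientations of a scatterer: `1` is a right scatterer, `-1` is a left scatterer. -/
abbrev Orientation : Type := ℤˣ

/-- The rotation operator `R[z]`: by the angle `π/3` clockwise (to the right) if `z = 1`, and
counterclockwise (to the left) if `z = -1`. -/
def rotationMatrix (z : Orientation) : Matrix (Fin 2) (Fin 2) ℝ :=
  !![Real.cos (Real.pi / 3 * ((z : ℤ) : ℝ)), Real.sin (Real.pi / 3 * ((z : ℤ) : ℝ));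
    -Real.sin (Real.pi / 3 * ((z : ℤ) : ℝ)), Real.cos (Real.pi / 3 * ((z : ℤ) : ℝ))]

/-- The action of `R[z]` on velocities. -/
def rotate (z : Orientation) (v : Plane) : Plane :=
  WithLp.toLp 2 ((rotationMatrix z).mulVec v.ofLp)

/-- A state of the flipping rotator model: the position of the particle (a site), its velocity
immediately after that time (a unit vector along a bond), and the orientations of all scatterers.
States also serve as initial conditions. -/
structure State where
  pos : sites
  vel : Plane
  config : sites → Orientation
  norm_vel : ‖vel‖ = 1
  next_mem : (pos : Plane) + vel ∈ sites

theorem rotate_zero (z : Orientation) (v : Plane) : rotate z v 0 = v 0 / 2 + √3 / 2 * z * v 1 := by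
  rcases Int.units_eq_one_or z with rfl | rfl <;>
    simp [rotate, rotationMatrix, dotProduct, Fin.sum_univ_two] <;> ring

theorem rotate_one (z : Orientation) (v : Plane) : rotate z v 1 = -(√3 / 2 * z * v 0) + v 1 / 2 := by
  rcases Int.units_eq_one_or z with rfl | rfl <;>
    simp [rotate, rotationMatrix, dotProduct, Fin.sum_univ_two] <;> ring

theorem norm_sq_eq (v : Plane) : ‖v‖ ^ 2 = v 0 ^ 2 + v 1 ^ 2 := by
  simp [EuclideanSpace.norm_sq_eq, Fin.sum_univ_two]

theorem norm_rotate (z : Orientation) (v : Plane) : ‖rotate z v‖ = ‖v‖ := by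
  have h3 : √3 ^ 2 = (3 : ℝ) := Real.sq_sqrt (by norm_num)
  have h : ‖rotate z v‖ ^ 2 = ‖v‖ ^ 2 := by
    rw [norm_sq_eq, norm_sq_eq, rotate_zero, rotate_one]
    rcases Int.units_eq_one_or z with rfl | rfl <;> push_cast <;> ring_nf <;> rw [h3] <;> ring
  exact (sq_eq_sq₀ (norm_nonneg _) (norm_nonneg _)).1 h

theorem plane_ext {x y : Plane} (h0 : x 0 = y 0) (h1 : x 1 = y 1) : x = y := by
  ext i; fin_cases i <;> assumption

theorem bond_cases {a b : ℤ} (h : a ^ 2 + a * b + b ^ 2 + a + b = 0) :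
    (a = 0 ∧ b = 0) ∨ (a = -1 ∧ b = 0) ∨ (a = 0 ∧ b = -1) := by
  have ha : -2 < a := by nlinarith [sq_nonneg (2 * b + a + 1)]
  have ha' : a < 2 := by nlinarith [sq_nonneg (2 * b + a + 1)]
  have hb : -2 < b := by nlinarith [sq_nonneg (2 * a + b + 1)]
  have hb' : b < 2 := by nlinarith [sq_nonneg (2 * a + b + 1)]
  interval_cases a <;> interval_cases b <;> simp_all

theorem translation_add (a b c d : ℤ) :
    translation a b + translation c d = translation (a + c) (b + d) := by
  apply plane_ext <;> simp [translation] <;> ring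

theorem rotate_neg (z : Orientation) (v : Plane) : rotate z (-v) = -rotate z v := by
  apply plane_ext <;> simp [rotate_zero, rotate_one] <;> ring

/-- The bonds leaving a translate of the origin. -/
theorem bond_of_unit {m n : ℤ} {v : Plane} (hv : ‖v‖ = 1) (h : translation m n + v ∈ sites) :
    ∃ a b : ℤ, v = !₂[(1 : ℝ), 0] + translation a b ∧
      ((a = 0 ∧ b = 0) ∨ (a = -1 ∧ b = 0) ∨ (a = 0 ∧ b = -1)) := by
  have h3 : √3 ^ 2 = (3 : ℝ) := Real.sq_sqrt (by norm_num)
  have hn : v 0 ^ 2 + v 1 ^ 2 = 1 := by rw [← norm_sq_eq, hv]; norm_num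
  obtain ⟨k, l, h | h⟩ := h
  · exfalso
    have hv' : v = translation (k - m) (l - n) := by
      have : translation k l = translation m n + translation (k - m) (l - n) := by
        rw [translation_add]; congr 1 <;> ring
      rw [this] at h; exact add_left_cancel h
    generalize k - m = a at hv'
    generalize l - n = b at hv'
    have f0 : v 0 = 3 / 2 * (a + b) := by simp [hv', translation]
    have f1 : v 1 = √3 / 2 * (a - b) := by simp [hv', translation]
    have g : (3 * (a ^ 2 + a * b + b ^ 2) : ℝ) = 1 := by
      rw [f0, f1] at hn; linear_combination hn - (a - b) ^ 2 / 4 * h3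
    have g' : (3 * (a ^ 2 + a * b + b ^ 2) : ℤ) = 1 := by exact_mod_cast g
    omega
  · have hv' : v = !₂[(1 : ℝ), 0] + translation (k - m) (l - n) := by
      have : translation k l = translation m n + translation (k - m) (l - n) := by
        rw [translation_add]; congr 1 <;> ring
      rw [this, add_left_comm] at h; exact add_left_cancel h
    refine ⟨k - m, l - n, hv', ?_⟩
    generalize k - m = a at hv'
    generalize l - n = b at hv'
    have f0 : v 0 = 1 + 3 / 2 * (a + b) := by simp [hv', translation]
    have f1 : v 1 = √3 / 2 * (a - b) := by simp [hv', translation]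
    have g : (a ^ 2 + a * b + b ^ 2 + a + b : ℝ) = 0 := by
      rw [f0, f1] at hn; linear_combination hn / 3 - (a - b) ^ 2 / 12 * h3
    exact bond_cases (by exact_mod_cast g)

theorem rotate_bond {a b : ℤ} (h : (a = 0 ∧ b = 0) ∨ (a = -1 ∧ b = 0) ∨ (a = 0 ∧ b = -1))
    (z : Orientation) :
    ∃ c d : ℤ, rotate z (!₂[(1 : ℝ), 0] + translation a b) = -(!₂[(1 : ℝ), 0] + translation c d) := by
  have h3 : √3 * √3 = (3 : ℝ) := Real.mul_self_sqrt (by norm_num)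
  have key : ∀ c d : ℤ,
      (1 + 3 / 2 * (a + b : ℝ)) / 2 + 3 / 4 * z * (a - b) = -(1 + 3 / 2 * (c + d : ℝ)) →
      -(z * (1 + 3 / 2 * (a + b : ℝ))) + (a - b : ℝ) / 2 = -(c - d : ℝ) →
      rotate z (!₂[(1 : ℝ), 0] + translation a b) = -(!₂[(1 : ℝ), 0] + translation c d) := by
    intro c d h0 h1
    apply plane_ext
    · rw [rotate_zero]
      simp [translation]
      linear_combination h0 + (z * (a - b) : ℝ) / 4 * h3
    · rw [rotate_one]
      simp [translation]
      linear_combination √3 / 2 * h1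
  rcases Int.units_eq_one_or z with rfl | rfl <;> rcases h with ⟨rfl, rfl⟩ | ⟨rfl, rfl⟩ | ⟨rfl, rfl⟩
  · exact ⟨0, -1, key _ _ (by norm_num) (by norm_num)⟩
  · exact ⟨0, 0, key _ _ (by norm_num) (by norm_num)⟩
  · exact ⟨-1, 0, key _ _ (by norm_num) (by norm_num)⟩
  · exact ⟨-1, 0, key _ _ (by norm_num) (by norm_num)⟩
  · exact ⟨0, -1, key _ _ (by norm_num) (by norm_num)⟩
  · exact ⟨0, 0, key _ _ (by norm_num) (by norm_num)⟩

theorem reflect_mem {x : Plane} (hx : x ∈ sites) : !₂[(1 : ℝ), 0] - x ∈ sites := by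
  obtain ⟨m, n, rfl | rfl⟩ := hx
  · refine ⟨-m, -n, Or.inr ?_⟩
    apply plane_ext <;> simp [translation] <;> ring
  · refine ⟨-m, -n, Or.inl ?_⟩
    apply plane_ext <;> simp [translation] <;> ring

/-- A scattered particle again moves along a bond of the lattice. -/
theorem rotate_mem {x v : Plane} (hx : x ∈ sites) (hv : ‖v‖ = 1) (hy : x + v ∈ sites)
    (z : Orientation) : x + v + rotate z v ∈ sites := by
  have main : ∀ (m n : ℤ) (v : Plane), ‖v‖ = 1 → translation m n + v ∈ sites →
      translation m n + v + rotate z v ∈ sites := by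
    intro m n v hv hy
    obtain ⟨a, b, rfl, hab⟩ := bond_of_unit hv hy
    obtain ⟨c, d, hcd⟩ := rotate_bond hab z
    refine ⟨m + a - c, n + b - d, Or.inl ?_⟩
    rw [hcd]
    apply plane_ext <;> simp [translation] <;> ring
  obtain ⟨m, n, rfl | rfl⟩ := hx
  · exact main m n v hv hy
  · have e : !₂[(1 : ℝ), 0] - (!₂[(1 : ℝ), 0] + translation m n) = translation (-m) (-n) := by
      apply plane_ext <;> simp [translation] <;> ring
    have h := reflect_mem hy
    rw [← sub_sub, e, sub_eq_add_neg] at h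
    have h' := reflect_mem (main _ _ (-v) (by rwa [norm_neg]) h)
    rw [rotate_neg, ← e] at h'
    convert h' using 1
    abel

/-- One time step: `r(t+1) = r(t) + v(t)`, `v(t+1) = R[C(t, r(t+1))] v(t)`, and the orientation of
the scatterer at `r(t+1)` is flipped, all others being unchanged. -/
def State.step (s : State) : State :=
  let r : sites := ⟨s.pos + s.vel, s.next_mem⟩
  open scoped Classical in
  { pos := r
    vel := rotate (s.config r) s.vel
    config := fun h => if h = r then -s.config h else s.config h
    norm_vel := by rw [norm_rotate, s.norm_vel]
    next_mem := rotate_mem s.pos.2 s.norm_vel s.next_mem _ }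

/-- The state at time `t` of the flipping rotator model with initial condition `I`. -/
def State.at (I : State) (t : ℕ) : State := State.step^[t] I

/-- The initial condition with position `(0, 0)`, velocity `(1, 0)` and configuration `C`. -/
def initialState (C : sites → Orientation) : State where
  pos := ⟨!₂[(0 : ℝ), 0], 0, 0, Or.inl (by apply plane_ext <;> simp [translation])⟩
  vel := !₂[(1 : ℝ), 0]
  config := C
  norm_vel := by simp [EuclideanSpace.norm_eq, Fin.sum_univ_two]
  next_mem := ⟨0, 0, Or.inr (by apply plane_ext <;> simp [translation])⟩

/-- The position `r(t)` of the particle, when it starts at `(0, 0)` with velocity `(1, 0)` and the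
initial configuration of the scatterers is `C`. -/
def position (C : sites → Orientation) (t : ℕ) : Plane := ((initialState C).at t).pos

end

end FlippingRotator

namespace FlippingRotator

/-! The dynamics is reversible: reversing the velocity makes the particle retrace its path and undo
its flips (`Walker.step_reverse_step`). Hence a step is injective, and a bounded trajectory is
periodic.

Let `0 < p < 1`. A particle that never returns to its initial bond leaves every triangle. Outside
the side that it crosses lies a lattice half-plane, with room for a fixed structure of 17 scatterers
that sends the particle back along the bond by which it came. It then retraces its path to the
initial bond (`exists_return_of_exit`). So, whatever is known inside a triangle, with conditional
probability at least `min p (1 - p) ^ 17` there is a return; by `measure_eq_zero_of_escape` the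
configurations without return are null. At every time the configuration differs from the initial one
on a finite set. There are countably many such sets, so almost surely each return is followed by
another.

If `p` is 0 or 1, all scatterers almost surely agree and the argument is deterministic. The bonds
are properly 3-coloured so that orientations record the cyclic order of colours. The particle then
follows a two-coloured (Kempe) chain (`IsColouring.iterate_step`), which closes up because a chain
running far out would circle a hexagon (`IsColouring.mem_periodicPts`). One circuit flips exactly
the scatterers of the chain, which amounts to swapping its colours (`IsColouring.swap`), so the
situation reproduces itself. -/

theorem zmod_three_cases (k : ZMod 3) : k = 0 ∨ k = 1 ∨ k = 2 := by
  revert k; decide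

theorem zmod_three_ne : (0 : ZMod 3) ≠ 1 ∧ (0 : ZMod 3) ≠ 2 ∧ (1 : ZMod 3) ≠ 0 ∧
    (1 : ZMod 3) ≠ 2 ∧ (2 : ZMod 3) ≠ 0 ∧ (2 : ZMod 3) ≠ 1 := by
  decide

theorem zmod_three_arith : (1 : ZMod 3) - 2 = 2 ∧ (2 : ZMod 3) - 1 = 1 ∧ (0 : ZMod 3) - 1 = 2 ∧
    (0 : ZMod 3) - 2 = 1 ∧ (1 : ZMod 3) + 1 = 2 ∧ (1 : ZMod 3) + 2 = 0 ∧ (2 : ZMod 3) + 1 = 0 ∧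
    (2 : ZMod 3) + 2 = 1 ∧ (-1 : ZMod 3) = 2 ∧ (-2 : ZMod 3) = 1 := by
  decide

/-! ### Combinatorial model and time reversal -/

/-- Coordinates for the sites: `(a, b, false)` stands for `translation a b`, and `(a, b, true)` for
`(1, 0) + translation a b`. -/
abbrev Cell : Type := ℤ × ℤ × Bool

/-- The neighbour of a site along the bond with label `k`. -/
def neighbour (p : Cell) (k : ZMod 3) : Cell :=
  (if k = 1 then p.1 + (if p.2.2 then 1 else -1) else p.1,
    if k = 2 then p.2.1 + (if p.2.2 then 1 else -1) else p.2.1, !p.2.2)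

/-- States in coordinates: position, label of the bond along which the particle leaves, and
orientations of the scatterers. -/
@[ext] structure Walker where
  pos : Cell
  dir : ZMod 3
  config : Cell → Orientation

/-- The label of the outgoing bond when a scatterer `z` is reached along the bond `k`. -/
def turn (k : ZMod 3) (z : Orientation) : ZMod 3 := k - ((z : ℤ) : ZMod 3)

/-- One time step in coordinates. -/
def Walker.step (x : Walker) : Walker where
  pos := neighbour x.pos x.dir
  dir := turn x.dir (x.config (neighbour x.pos x.dir))
  config := Function.update x.config (neighbour x.pos x.dir)
    (-x.config (neighbour x.pos x.dir))

/-- Reversal of the velocity. -/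
def Walker.reverse (x : Walker) : Walker := ⟨neighbour x.pos x.dir, x.dir, x.config⟩

@[simp] theorem neighbour_neighbour (p : Cell) (k : ZMod 3) :
    neighbour (neighbour p k) k = p := by
  obtain ⟨a, b, s⟩ := p
  rcases zmod_three_cases k with rfl | rfl | rfl <;> cases s <;> simp [neighbour, zmod_three_ne]

@[simp] theorem turn_turn_neg (k : ZMod 3) (z : Orientation) : turn (turn k z) (-z) = k := by
  simp [turn]

@[simp] theorem Walker.reverse_reverse (x : Walker) : x.reverse.reverse = x := by
  simp [Walker.reverse]

/-- The scatterer just met has been flipped, so on the way back it turns the particle onto the old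
bond, and the second visit restores its orientation. -/
theorem Walker.step_reverse_step (x : Walker) : x.step.reverse.step = x.reverse := by
  simp [Walker.step, Walker.reverse]

theorem Walker.step_injective : Function.Injective Walker.step := by
  intro x y h
  have := Walker.step_reverse_step x
  rw [h, Walker.step_reverse_step] at this
  rw [← x.reverse_reverse, ← this, y.reverse_reverse]

theorem Walker.iterate_reverse (x : Walker) (n i : ℕ) (hi : i ≤ n) :
    Walker.step^[i] (Walker.step^[n] x).reverse = (Walker.step^[n - i] x).reverse := by
  induction i with
  | zero => rfl
  | succ i ih =>
    rw [Function.iterate_succ_apply', ih (by omega), show n - i = (n - (i + 1)) + 1 by omega,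
      Function.iterate_succ_apply', Walker.step_reverse_step]

/-- The trajectory depends only on the orientations of the sites visited. -/
theorem Walker.iterate_congr {B : Set Cell} {x y : Walker} (hp : x.pos = y.pos)
    (hd : x.dir = y.dir) (hc : ∀ q ∈ B, x.config q = y.config q) (t : ℕ)
    (hB : ∀ i < t, (Walker.step^[i + 1] x).pos ∈ B) :
    (Walker.step^[t] x).pos = (Walker.step^[t] y).pos ∧
      (Walker.step^[t] x).dir = (Walker.step^[t] y).dir ∧
      ∀ q ∈ B, (Walker.step^[t] x).config q = (Walker.step^[t] y).config q := by
  induction t with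
  | zero => exact ⟨hp, hd, hc⟩
  | succ t ih =>
    obtain ⟨h1, h2, h3⟩ := ih fun i hi => hB i (by omega)
    have hm := hB t (by omega)
    rw [Function.iterate_succ_apply'] at hm
    have hm' : neighbour (Walker.step^[t] y).pos (Walker.step^[t] y).dir ∈ B := by
      rw [← h1, ← h2]; exact hm
    simp only [Function.iterate_succ_apply', Walker.step]
    rw [h1, h2, h3 _ hm']
    refine ⟨rfl, rfl, fun q hq => ?_⟩
    by_cases e : q = neighbour (Walker.step^[t] y).pos (Walker.step^[t] y).dir
    · subst e; simp
    · simp [e, h3 q hq]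

theorem Walker.iterate_config_of_unvisited {x : Walker} {q : Cell} (t : ℕ)
    (h : ∀ i < t, (Walker.step^[i + 1] x).pos ≠ q) :
    (Walker.step^[t] x).config q = x.config q := by
  induction t with
  | zero => rfl
  | succ t ih =>
    have hq := h t (by omega)
    rw [Function.iterate_succ_apply'] at hq ⊢
    rw [← ih fun i hi => h i (by omega)]
    exact Function.update_of_ne (Ne.symm hq) _ _

/-- Only the orientations in `B` can change, so finitely many states occur and one repeats;
injectivity of a step carries the repetition back to `x` itself. -/
theorem Walker.exists_iterate_eq_of_bounded {x : Walker} (B : Finset Cell)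
    (h : ∀ i, (Walker.step^[i + 1] x).pos ∈ B) : ∃ t, Walker.step^[t + 1] x = x := by
  let f : ℕ → B × ZMod 3 × (B → Orientation) := fun i =>
    (⟨_, h i⟩, (Walker.step^[i + 1] x).dir, fun q => (Walker.step^[i + 1] x).config q)
  obtain ⟨i, j, hij, hf⟩ : ∃ i j, i < j ∧ f i = f j := by
    obtain ⟨i, j, hij, hf⟩ := Finite.exists_ne_map_eq_of_infinite f
    rcases lt_or_gt_of_ne hij with h | h
    exacts [⟨i, j, h, hf⟩, ⟨j, i, h, hf.symm⟩]
  simp only [f, Prod.mk.injEq, Subtype.mk.injEq] at hf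
  have key : Walker.step^[i + 1] x = Walker.step^[j + 1] x := by
    refine Walker.ext hf.1 hf.2.1 (funext fun q => ?_)
    by_cases hq : q ∈ B
    · exact congrFun hf.2.2 ⟨q, hq⟩
    · have hne : ∀ i, (Walker.step^[i + 1] x).pos ≠ q := fun i e => hq (e ▸ h i)
      rw [Walker.iterate_config_of_unvisited _ fun i _ => hne i,
        Walker.iterate_config_of_unvisited _ fun i _ => hne i]
  refine ⟨j - i - 1, ?_⟩
  have e : j + 1 = (i + 1) + (j - i - 1 + 1) := by omega
  rw [e, Function.iterate_add_apply _ (i + 1) (j - i - 1 + 1)] at key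
  exact ((Walker.step_injective.iterate _) key).symm

/-! ### Lattice symmetries and triangles -/

/-- A symmetry of the lattice that shifts the labels of the bonds by `j` carries trajectories to
trajectories. -/
theorem Walker.iterate_map {φ : Cell → Cell} (hφ : Function.Injective φ) {j : ZMod 3}
    (hn : ∀ p k, neighbour (φ p) (k + j) = φ (neighbour p k)) (p : Cell) (k : ZMod 3)
    (C : Cell → Orientation) (t : ℕ) :
    (Walker.step^[t] ⟨φ p, k + j, C⟩).pos = φ (Walker.step^[t] ⟨p, k, C ∘ φ⟩).pos ∧
    (Walker.step^[t] ⟨φ p, k + j, C⟩).dir = (Walker.step^[t] ⟨p, k, C ∘ φ⟩).dir + j ∧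
    (Walker.step^[t] ⟨φ p, k + j, C⟩).config ∘ φ = (Walker.step^[t] ⟨p, k, C ∘ φ⟩).config := by
  induction t with
  | zero => exact ⟨rfl, rfl, rfl⟩
  | succ t ih =>
    obtain ⟨h1, h2, h3⟩ := ih
    simp only [Function.iterate_succ_apply', Walker.step, h1, h2, hn, ← h3, turn,
      Function.comp_apply]
    refine ⟨trivial, by ring, ?_⟩
    funext q
    by_cases e : q = neighbour (Walker.step^[t] ⟨p, k, C ∘ φ⟩).pos
      (Walker.step^[t] ⟨p, k, C ∘ φ⟩).dir
    · subst e; simp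
    · simp [e, hφ.eq_iff]

/-- The coordinate that changes along the bonds with label `k`. -/
def coord (p : Cell) (k : ZMod 3) : ℤ :=
  if k = 1 then p.1 else if k = 2 then p.2.1 else -p.1 - p.2.1 - (if p.2.2 then 1 else 0)

theorem coord_neighbour (p : Cell) (k l : ZMod 3) :
    coord (neighbour p k) l =
      coord p l + if l = k then (if p.2.2 then 1 else -1) else 0 := by
  obtain ⟨a, b, s⟩ := p
  rcases zmod_three_cases k with rfl | rfl | rfl <;>
    rcases zmod_three_cases l with rfl | rfl | rfl <;> cases s <;>
    simp [neighbour, coord, zmod_three_ne] <;> omega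

/-- The translation by `c` followed by a rotation that shifts the bond labels by `j`. -/
def motion (c : ℤ × ℤ) (j : ZMod 3) (p : Cell) : Cell :=
  (coord p (1 - j) + c.1, coord p (2 - j) + c.2, p.2.2)

theorem coord_motion (c : ℤ × ℤ) (j : ZMod 3) (p : Cell) (l : ZMod 3) :
    coord (motion c j p) l =
      coord p (l - j) + if l = 1 then c.1 else if l = 2 then c.2 else -c.1 - c.2 := by
  obtain ⟨a, b, s⟩ := p
  rcases zmod_three_cases j with rfl | rfl | rfl <;>
    rcases zmod_three_cases l with rfl | rfl | rfl <;> cases s <;>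
    simp [motion, coord, zmod_three_ne, zmod_three_arith] <;> omega

theorem cell_ext {p q : Cell} (h : ∀ l, coord p l = coord q l) (hs : p.2.2 = q.2.2) : p = q := by
  have h1 := h 1
  have h2 := h 2
  simp only [coord, zmod_three_ne, if_true, if_false] at h1 h2
  exact Prod.ext h1 (Prod.ext h2 hs)

theorem motion_injective (c : ℤ × ℤ) (j : ZMod 3) : Function.Injective (motion c j) := by
  intro p q h
  refine cell_ext (fun l => ?_) (congrArg (fun x : Cell => x.2.2) h :)
  have := congrArg (fun x => coord x (l + j)) h
  simpa [coord_motion] using this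

theorem neighbour_motion (c : ℤ × ℤ) (j : ZMod 3) (p : Cell) (k : ZMod 3) :
    neighbour (motion c j p) (k + j) = motion c j (neighbour p k) := by
  refine cell_ext (fun l => ?_) rfl
  rw [coord_neighbour, coord_motion, coord_motion, coord_neighbour]
  by_cases h : l = k + j
  · have h' : l - j = k := sub_eq_iff_eq_add.2 h
    rw [if_pos h, if_pos h']
    exact add_right_comm _ _ _
  · have h' : l - j ≠ k := fun e => h (sub_eq_iff_eq_add.1 e)
    rw [if_neg h, if_neg h']
    ring

/-- The sites all of whose coordinates are at most `N`. -/
noncomputable def triangle (N : ℕ) : Finset Cell :=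
  (Finset.Icc (-2 * N - 1 : ℤ) N ×ˢ Finset.Icc (-2 * N - 1 : ℤ) N ×ˢ Finset.univ).filter
    fun p => ∀ l, coord p l ≤ N

theorem mem_triangle {N : ℕ} {p : Cell} : p ∈ triangle N ↔ ∀ l, coord p l ≤ N := by
  simp only [triangle, Finset.mem_filter, Finset.mem_product, Finset.mem_Icc, Finset.mem_univ,
    and_true, and_iff_right_iff_imp]
  -- The three coordinates sum to 0 or -1, so the upper bounds `N` force the lower bounds `-2 * N -
  -- 1`.
  intro h
  obtain ⟨a, b, s⟩ := p
  have h0 := h 0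
  have h1 := h 1
  have h2 := h 2
  cases s <;> simp [coord, zmod_three_ne] at h0 h1 h2 ⊢ <;> omega

theorem triangle_mono : Monotone triangle := by
  intro M N h p hp
  rw [mem_triangle] at hp ⊢
  exact fun l => (hp l).trans (by exact_mod_cast h)

theorem exists_subset_triangle (F : Finset Cell) : ∃ N, F ⊆ triangle N := by
  induction F using Finset.induction with
  | empty => exact ⟨0, by simp⟩
  | insert p F _ ih =>
    obtain ⟨N, hN⟩ := ih
    let M := (coord p 0).toNat + (coord p 1).toNat + (coord p 2).toNat
    refine ⟨N + M, Finset.insert_subset (mem_triangle.2 fun l => ?_)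
      (hN.trans (triangle_mono (by omega)))⟩
    rcases zmod_three_cases l with rfl | rfl | rfl <;> simp only [M] <;> omega

/-! ### The reflecting structure -/

/-- The orientations of the scatterers of a reflecting structure, which is entered at
`(0, 0, false)` along the bond with label `1`. -/
def reflectorConfig (p : Cell) : Orientation :=
  if p ∈ [(0, 0, false), (0, 0, true), (1, 0, true), (1, -1, true), (1, -1, false),
    (0, -1, true)] then 1 else -1

/-- The sites of a reflecting structure. -/
def reflectorCells : Finset Cell :=
  {(0, 0, false), (0, 0, true), (0, 1, false), (0, 1, true), (1, 1, false), (1, 0, true),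
    (2, 0, false), (2, -1, true), (2, -1, false), (1, -1, true), (1, -1, false), (1, -2, true),
    (1, -2, false), (0, -2, true), (0, -1, false), (0, -1, true), (1, 0, false)}

/-- The state in which the particle enters the reflecting structure. -/
def reflectorStart : Walker := ⟨(-1, 0, true), 1, reflectorConfig⟩

theorem reflector_stays : ∀ i < 23, (Walker.step^[i + 1] reflectorStart).pos ∈ reflectorCells := by
  decide +kernel

theorem reflector_pos : (Walker.step^[23] reflectorStart).pos = (0, 0, false) := by
  decide +kernel

theorem reflector_dir : (Walker.step^[23] reflectorStart).dir = 1 := by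
  decide +kernel

/-- The structure lies on the far side of the entrance bond, so it can be placed outside any
triangle. -/
theorem coord_reflectorCells : ∀ p ∈ reflectorCells, 0 ≤ coord p 1 := by
  decide

theorem card_reflectorCells : reflectorCells.card = 17 := by
  decide

/-! ### Null sets of configurations -/

section Probability

open MeasureTheory ProbabilityTheory

variable {ι Ω : Type*} [MeasurableSpace Ω] {P : Measure Ω}
  {X : ι → Ω → Orientation}

/-- The event that the orientations at the sites in `S` are given by `ζ`. -/
def cylinder (X : ι → Ω → Orientation) (S : Finset ι) (ζ : ι → Orientation) : Set Ω :=
  {ω | ∀ i ∈ S, X i ω = ζ i}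

theorem measurableSet_orientation (s : Set Orientation) : MeasurableSet s := by
  exact ⟨Units.val '' s, trivial, Set.preimage_image_eq _ Units.val_injective⟩

theorem measurableSet_cylinder (hX : ∀ i, Measurable (X i)) (S : Finset ι)
    (ζ : ι → Orientation) : MeasurableSet (cylinder X S ζ) := by
  have : cylinder X S ζ = ⋂ i ∈ S, X i ⁻¹' {ζ i} := by ext; simp [cylinder]
  rw [this]
  exact S.measurableSet_biInter fun i _ => hX i (measurableSet_orientation _)

theorem measure_cylinder (hi : iIndepFun X P) (S : Finset ι) (ζ : ι → Orientation) :
    P (cylinder X S ζ) = ∏ i ∈ S, P (X i ⁻¹' {ζ i}) := by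
  have : cylinder X S ζ = ⋂ i ∈ S, X i ⁻¹' {ζ i} := by ext; simp [cylinder]
  rw [this]
  exact hi.measure_inter_preimage_eq_mul S fun i _ => measurableSet_orientation _

theorem measure_cylinder_inter [DecidableEq ι] (hi : iIndepFun X P) {S T : Finset ι}
    (hST : Disjoint S T) (ζ η : ι → Orientation) :
    P (cylinder X S ζ ∩ cylinder X T η) = P (cylinder X S ζ) * P (cylinder X T η) := by
  let θ : ι → Orientation := fun i => if i ∈ S then ζ i else η i
  have hT : ∀ i ∈ T, θ i = η i := fun i h => if_neg fun h' => Finset.disjoint_left.1 hST h' h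
  have hS : ∀ i ∈ S, θ i = ζ i := fun i h => if_pos h
  have e : cylinder X S ζ ∩ cylinder X T η = cylinder X (S ∪ T) θ := by
    ext ω
    simp only [cylinder, Set.mem_inter_iff, Set.mem_ofPred_eq, Finset.mem_union]
    constructor
    · rintro ⟨h1, h2⟩ i (h | h)
      · rw [hS i h, h1 i h]
      · rw [hT i h, h2 i h]
    · intro h
      exact ⟨fun i hi => (h i (Or.inl hi)).trans (hS i hi),
        fun i hi => (h i (Or.inr hi)).trans (hT i hi)⟩
  rw [e, measure_cylinder hi, measure_cylinder hi, measure_cylinder hi, Finset.prod_union hST]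
  congr 1
  · exact Finset.prod_congr rfl fun i h => by rw [hS i h]
  · exact Finset.prod_congr rfl fun i h => by rw [hT i h]

theorem pow_le_measure_cylinder (hi : iIndepFun X P) {m : ENNReal} (hm1 : m ≤ 1)
    (hm : ∀ i z, m ≤ P (X i ⁻¹' {z})) {d : ℕ} {S : Finset ι} (hS : S.card ≤ d)
    (ζ : ι → Orientation) : m ^ d ≤ P (cylinder X S ζ) := by
  rw [measure_cylinder hi]
  calc m ^ d ≤ m ^ S.card := pow_le_pow_right_of_le_one' hm1 hS
    _ ≤ _ := Finset.pow_card_le_prod S _ m fun i _ => hm i _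

/-- A closed set of configurations from which one can always escape by prescribing a bounded number
of orientations outside any given finite region is null. -/
theorem measure_eq_zero_of_escape [DecidableEq ι] [IsProbabilityMeasure P]
    (hX : ∀ i, Measurable (X i)) (hi : iIndepFun X P) {m : ENNReal} (hm0 : m ≠ 0) (hm1 : m ≤ 1)
    (hm : ∀ i z, m ≤ P (X i ⁻¹' {z})) {B : ℕ → Finset ι} (hB : Monotone B) (d : ℕ)
    (K : Set (ι → Orientation))
    (hclosed : ∀ C ∉ K, ∃ n, ∀ C', (∀ i ∈ B n, C' i = C i) → C' ∉ K)
    (hescape : ∀ C ∈ K, ∀ n, ∃ D : Finset ι, D.card ≤ d ∧ Disjoint (B n) D ∧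
      ∃ η : ι → Orientation, ∀ C', (∀ i ∈ B n, C' i = C i) → (∀ i ∈ D, C' i = η i) → C' ∉ K) :
    P {ω | (fun i => X i ω) ∈ K} = 0 := by
  classical
  set A : Set Ω := {ω | (fun i => X i ω) ∈ K} with hA
  let Xi : ∀ n, Set (B n → Orientation) := fun n => {ξ | ∃ C ∈ K, ∀ i : B n, C i = ξ i}
  let ext : ∀ n, (B n → Orientation) → ι → Orientation :=
    fun n ξ i => if h : i ∈ B n then ξ ⟨i, h⟩ else 1
  let E : ℕ → Set Ω := fun n => ⋃ ξ ∈ Xi n, cylinder X (B n) (ext n ξ)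
  have hcyl : ∀ n ξ ω, ω ∈ cylinder X (B n) (ext n ξ) ↔ ∀ i : B n, X i ω = ξ i := by
    intro n ξ ω
    simp only [cylinder, Set.mem_ofPred_eq, Subtype.forall]
    refine forall₂_congr fun i hi => ?_
    simp [ext, hi]
  -- `E n` is the event that what is seen in `B n` is still compatible with `K`. These events
  -- decrease to `A` because `K` is closed.
  have hmemE : ∀ n ω, ω ∈ E n ↔ ∃ C ∈ K, ∀ i ∈ B n, C i = X i ω := by
    intro n ω
    simp only [E, Set.mem_iUnion, hcyl, Xi, Set.mem_ofPred_eq]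
    constructor
    · rintro ⟨ξ, ⟨C, hC, h1⟩, h2⟩
      exact ⟨C, hC, fun i hi => (h1 ⟨i, hi⟩).trans (h2 ⟨i, hi⟩).symm⟩
    · rintro ⟨C, hC, h⟩
      exact ⟨fun i => X i ω, ⟨C, hC, fun i => h i i.2⟩, fun _ => rfl⟩
  have hEmeas : ∀ n, MeasurableSet (E n) := fun n =>
    (Set.toFinite (Xi n)).measurableSet_biUnion fun ξ _ => measurableSet_cylinder hX _ _
  have hEanti : Antitone E := by
    intro n n' h ω hω
    rw [hmemE] at hω ⊢
    obtain ⟨C, hC, h'⟩ := hω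
    exact ⟨C, hC, fun i hi => h' i (hB h hi)⟩
  have hAE : A = ⋂ n, E n := by
    ext ω
    simp only [Set.mem_iInter, hmemE]
    refine ⟨fun h n => ⟨_, h, fun _ _ => rfl⟩, fun h => ?_⟩
    by_contra hω
    obtain ⟨n, hn⟩ := hclosed _ hω
    obtain ⟨C, hC, h'⟩ := h n
    exact hn C h' hC
  have hdisj : ∀ n, (Xi n).PairwiseDisjoint fun ξ => cylinder X (B n) (ext n ξ) := by
    intro n ξ _ ξ' _ hne
    refine Set.disjoint_left.2 fun ω h h' => hne (funext fun i => ?_)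
    rw [hcyl] at h h'
    rw [← h i, ← h' i]
  -- Given the pattern `ξ` in `B n`, the escape pattern on the disjoint set `D` is independent of it
  -- and has probability at least `m ^ d`.
  have hloc : ∀ n, ∀ ξ ∈ Xi n, P (A ∩ cylinder X (B n) (ext n ξ)) +
      m ^ d * P (cylinder X (B n) (ext n ξ)) ≤ P (cylinder X (B n) (ext n ξ)) := by
    rintro n ξ ⟨C, hC, hCξ⟩
    obtain ⟨D, hcard, hD, η, hη⟩ := hescape C hC n
    set Z := cylinder X (B n) (ext n ξ) with hZ
    have h1 : Disjoint (A ∩ Z) (Z ∩ cylinder X D η) := by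
      refine Set.disjoint_left.2 fun ω h h' => ?_
      refine hη _ (fun i hi => ?_) h'.2 h.1
      rw [hCξ ⟨i, hi⟩]
      exact (hcyl n ξ ω).1 h.2 ⟨i, hi⟩
    calc P (A ∩ Z) + m ^ d * P Z ≤ P (A ∩ Z) + P (Z ∩ cylinder X D η) := by
          rw [hZ, measure_cylinder_inter hi hD, mul_comm (m ^ d)]
          gcongr
          exact pow_le_measure_cylinder hi hm1 hm hcard η
      _ = P ((A ∩ Z) ∪ (Z ∩ cylinder X D η)) := (measure_union h1
          ((measurableSet_cylinder hX _ _).inter (measurableSet_cylinder hX _ _))).symm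
      _ ≤ P Z := measure_mono (by
          rintro ω (h | h)
          exacts [h.2, h.1])
  have hstep : ∀ n, P A + m ^ d * P (E n) ≤ P (E n) := by
    intro n
    have hf := Set.toFinite (Xi n)
    have hPE : P (E n) = ∑ ξ ∈ hf.toFinset, P (cylinder X (B n) (ext n ξ)) := by
      rw [← measure_biUnion_finset (by rw [hf.coe_toFinset]; exact hdisj n)
        fun ξ _ => measurableSet_cylinder hX _ _]
      simp only [E, Set.Finite.mem_toFinset]
    have hPA : P A ≤ ∑ ξ ∈ hf.toFinset, P (A ∩ cylinder X (B n) (ext n ξ)) := by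
      refine (measure_mono ?_).trans (measure_biUnion_finset_le _ _)
      intro ω hω
      have : ω ∈ E n := by rw [hAE] at hω; exact Set.mem_iInter.1 hω n
      simp only [E, Set.mem_iUnion] at this
      obtain ⟨ξ, h1, h2⟩ := this
      simp only [Set.mem_iUnion]
      exact ⟨ξ, hf.mem_toFinset.2 h1, hω, h2⟩
    calc P A + m ^ d * P (E n)
        ≤ ∑ ξ ∈ hf.toFinset, (P (A ∩ cylinder X (B n) (ext n ξ)) +
            m ^ d * P (cylinder X (B n) (ext n ξ))) := by
          rw [Finset.sum_add_distrib, ← Finset.mul_sum, ← hPE]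
          gcongr
      _ ≤ P (E n) := by
          rw [hPE]
          exact Finset.sum_le_sum fun ξ h => hloc n ξ (hf.mem_toFinset.1 h)
  have hlim : Filter.Tendsto (fun n => P (E n)) Filter.atTop (nhds (P A)) := by
    rw [hAE]
    exact tendsto_measure_iInter_atTop (fun n => (hEmeas n).nullMeasurableSet) hEanti
      ⟨0, measure_ne_top _ _⟩
  -- Since `A ⊆ E n`, the limit of `hstep` leaves no room for positive mass.
  have hfin : P A + m ^ d * P A ≤ P A := by
    refine ge_of_tendsto' hlim fun n => ?_
    refine le_trans ?_ (hstep n)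
    gcongr
    rw [hAE]
    exact Set.iInter_subset _ n
  have h0 : m ^ d * P A = 0 := by
    have : P A + m ^ d * P A ≤ P A + 0 := by simpa using hfin
    exact nonpos_iff_eq_zero.1 ((ENNReal.add_le_add_iff_left (measure_ne_top _ _)).1 this)
  exact (mul_eq_zero.1 h0).resolve_left (pow_ne_zero _ hm0)

end Probability

/-! ### Forcing a return from outside a triangle -/

/-- A move along the bond `k` changes only the coordinate `k`, by one, and raises it only from the
sublattice `true`. -/
theorem exit_triangle {N : ℕ} {p : Cell} {k : ZMod 3} (hp : p ∈ triangle N)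
    (hq : neighbour p k ∉ triangle N) : p.2.2 = true ∧ coord p k = N := by
  rw [mem_triangle] at hp hq
  push Not at hq
  obtain ⟨l, hl⟩ := hq
  rw [coord_neighbour] at hl
  have h := hp l
  by_cases e : l = k
  · subst e
    cases hs : p.2.2
    · simp [hs] at hl; omega
    · simp [hs] at hl; exact ⟨rfl, by omega⟩
  · simp [e] at hl; omega

/-- Beyond the point where the particle leaves a triangle, a bounded number of scatterers can be
oriented so that the particle is reflected. -/
theorem exists_reflector {N : ℕ} {p : Cell} {k : ZMod 3} (hp : p ∈ triangle N)
    (hq : neighbour p k ∉ triangle N) :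
    ∃ D : Finset Cell, D.card ≤ 17 ∧ Disjoint (triangle N) D ∧ ∃ η : Cell → Orientation,
      ∀ C : Cell → Orientation, (∀ q ∈ D, C q = η q) →
        (Walker.step^[23] ⟨p, k, C⟩).pos = neighbour p k ∧
        (Walker.step^[23] ⟨p, k, C⟩).dir = k ∧
        ∀ q ∈ triangle N, (Walker.step^[23] ⟨p, k, C⟩).config q = C q := by
  classical
  obtain ⟨hs, hN⟩ := exit_triangle hp hq
  obtain ⟨j, rfl⟩ : ∃ j, k = 1 + j := ⟨k - 1, by ring⟩
  let b : Cell := (-1, 0, true)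
  -- The translation is chosen so that the site `b` before the model reflector goes to the exit site
  -- `p`.
  let c : ℤ × ℤ := (p.1 - coord b (1 - j), p.2.1 - coord b (2 - j))
  have hb : motion c j b = p := by
    refine Prod.ext ?_ (Prod.ext ?_ hs.symm) <;> simp [motion, c]
  have hcoord : ∀ q, coord (motion c j q) (1 + j) = coord q 1 + (N + 1) := by
    intro q
    have h := coord_motion c j b (1 + j)
    rw [hb, hN] at h
    have h1 : coord b 1 = -1 := rfl
    rw [coord_motion]
    simp only [add_sub_cancel_right, h1] at h ⊢
    omega
  have hdisj : ∀ q ∈ reflectorCells, motion c j q ∉ triangle N := by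
    intro q hq' hm
    have h1 := mem_triangle.1 hm (1 + j)
    have h2 := coord_reflectorCells q hq'
    rw [hcoord] at h1
    omega
  refine ⟨reflectorCells.image (motion c j), ?_, ?_,
    Function.extend (motion c j) reflectorConfig 1, ?_⟩
  · exact Finset.card_image_le.trans card_reflectorCells.le
  · refine Finset.disjoint_right.2 fun q hq' => ?_
    obtain ⟨q, h, rfl⟩ := Finset.mem_image.1 hq'
    exact hdisj q h
  intro C hC
  have hagree : ∀ q ∈ (reflectorCells : Set Cell),
      reflectorStart.config q = (Walker.mk b 1 (C ∘ motion c j)).config q := by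
    intro q hq'
    have := hC _ (Finset.mem_image_of_mem _ hq')
    rw [(motion_injective c j).extend_apply] at this
    exact this.symm
  have hrun := fun t ht => Walker.iterate_congr (x := reflectorStart)
    (y := ⟨b, 1, C ∘ motion c j⟩) rfl rfl hagree t ht
  have hmap := Walker.iterate_map (motion_injective c j) (neighbour_motion c j) b 1 C
  rw [hb] at hmap
  have hend := hrun 23 reflector_stays
  refine ⟨?_, ?_, fun q hq' => ?_⟩
  · rw [(hmap 23).1, ← hend.1, reflector_pos, ← hb, neighbour_motion]
    rfl
  · rw [(hmap 23).2.1, ← hend.2.1, reflector_dir]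
  · refine Walker.iterate_config_of_unvisited 23 fun i hi e => ?_
    rw [(hmap (i + 1)).1, ← (hrun (i + 1) fun i' hi' => reflector_stays i' (by omega)).1] at e
    exact hdisj _ (reflector_stays i hi) (e ▸ hq')

/-- If the particle leaves a triangle, then it can be made to return with its velocity reversed by
choosing the orientations of a bounded number of scatterers outside the triangle. -/
theorem exists_return_of_exit {N : ℕ} (x : Walker) (hx : x.pos ∈ triangle N)
    (hexit : ∃ i, (Walker.step^[i + 1] x).pos ∉ triangle N) :
    ∃ D : Finset Cell, D.card ≤ 17 ∧ Disjoint (triangle N) D ∧ ∃ η : Cell → Orientation,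
      ∀ C : Cell → Orientation, (∀ q ∈ triangle N, C q = x.config q) → (∀ q ∈ D, C q = η q) →
        ∃ t, (Walker.step^[t + 1] ⟨x.pos, x.dir, C⟩).pos = x.reverse.pos ∧
          (Walker.step^[t + 1] ⟨x.pos, x.dir, C⟩).dir = x.reverse.dir := by
  classical
  obtain ⟨n, hn, hmin⟩ : ∃ n, (Walker.step^[n + 1] x).pos ∉ triangle N ∧
      ∀ i < n, (Walker.step^[i + 1] x).pos ∈ triangle N :=
    ⟨Nat.find hexit, Nat.find_spec hexit, fun i hi => not_not.1 (Nat.find_min hexit hi)⟩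
  have hpos : (Walker.step^[n] x).pos ∈ triangle N := by
    cases n with
    | zero => exact hx
    | succ n => exact hmin n (by omega)
  rw [Function.iterate_succ_apply'] at hn
  obtain ⟨D, hcard, hdisj, η, hη⟩ := exists_reflector hpos hn
  refine ⟨D, hcard, hdisj, η, fun C hC hD => ?_⟩
  set x' : Walker := ⟨x.pos, x.dir, C⟩ with hx'
  have hcongr := fun t ht => Walker.iterate_congr (B := (triangle N : Set Cell)) (x := x)
    (y := x') rfl rfl (fun q hq => (hC q hq).symm) t ht
  have hin : ∀ i < n, (Walker.step^[i + 1] x').pos ∈ triangle N := fun i hi => by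
    rw [← (hcongr (i + 1) fun i' hi' => hmin i' (by omega)).1]
    exact hmin i hi
  obtain ⟨h1, h2, -⟩ := hcongr n hmin
  have hD' : ∀ q ∈ D, (Walker.step^[n] x').config q = η q := fun q hq => by
    rw [Walker.iterate_config_of_unvisited n fun i hi e =>
      Finset.disjoint_left.1 hdisj (hin i hi) (e ▸ hq)]
    exact hD q hq
  obtain ⟨g1, g2, g3⟩ := hη _ hD'
  have hy : (⟨(Walker.step^[n] x).pos, (Walker.step^[n] x).dir,
      (Walker.step^[n] x').config⟩ : Walker) = Walker.step^[n] x' := Walker.ext h1 h2 rfl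
  rw [hy] at g1 g2 g3
  -- On the triangle, the reflected state coincides with the reversal of the state at time `n`. The
  -- way back stays in the triangle, so the altered scatterers of the reflector do not matter.
  have hback := Walker.iterate_congr (B := (triangle N : Set Cell))
    (x := (Walker.step^[n] x').reverse) (y := Walker.step^[23] (Walker.step^[n] x'))
    (by rw [g1, h1, h2]; rfl) (by rw [g2, h2]; rfl) (fun q hq => (g3 q hq).symm) n
    (fun i hi => by
      rw [Walker.iterate_reverse x' n (i + 1) (by omega)]
      have := hin (n - (i + 1)) (by omega)
      rwa [Function.iterate_succ_apply'] at this)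
  rw [Walker.iterate_reverse x' n n le_rfl, Nat.sub_self] at hback
  -- `n` steps out, 23 in the reflector and `n` back; one of them is the `+ 1` of the statement.
  refine ⟨n + (22 + n), ?_⟩
  rw [show n + (22 + n) + 1 = n + (23 + n) by omega, Function.iterate_add_apply _ n,
    Function.iterate_add_apply _ 23]
  exact ⟨hback.1.symm, hback.2.1.symm⟩

/-- The configuration with the scatterers in `F` flipped. -/
def flip (F : Finset Cell) (C : Cell → Orientation) (q : Cell) : Orientation :=
  if q ∈ F then -C q else C q

theorem flip_flip (F : Finset Cell) (C : Cell → Orientation) : flip F (flip F C) = C := by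
  funext q
  by_cases h : q ∈ F <;> simp [flip, h]

theorem flip_congr (F : Finset Cell) {C C' : Cell → Orientation} {q : Cell} (h : C q = C' q) :
    flip F C q = flip F C' q := by
  simp [flip, h]

theorem exists_flip_update (F : Finset Cell) (C : Cell → Orientation) (q : Cell) :
    ∃ F', Function.update (flip F C) q (-flip F C q) = flip F' C := by
  refine ⟨if q ∈ F then F.erase q else insert q F, funext fun r => ?_⟩
  by_cases e : r = q
  · subst e
    by_cases h : r ∈ F <;> simp [flip, h]
  · by_cases h : q ∈ F <;> simp [flip, e, h]

theorem Walker.exists_iterate_config_eq_flip {x : Walker} {C : Cell → Orientation}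
    (hx : ∃ F, x.config = flip F C) (t : ℕ) :
    ∃ F, (Walker.step^[t] x).config = flip F C := by
  induction t with
  | zero => exact hx
  | succ t ih =>
    obtain ⟨F, hF⟩ := ih
    rw [Function.iterate_succ_apply']
    simp only [Walker.step, hF]
    exact exists_flip_update F _ _

/-- The particle traverses the bond between `(0, 0)` and `(1, 0)`. -/
def Walker.IsHome (x : Walker) : Prop :=
  (x.pos = (0, 0, false) ∨ x.pos = (0, 0, true)) ∧ x.dir = 0

/-- The configurations for which the particle, after the scatterers in `F` have been flipped, never
returns to the bond between `(0, 0)` and `(1, 0)`, starting there from the end given by `s`. -/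
def noReturn (F : Finset Cell) (s : Bool) : Set (Cell → Orientation) :=
  {C | ∀ t, ¬ (Walker.step^[t + 1] ⟨(0, 0, s), 0, flip F C⟩).IsHome}

/-- A return happens in finite time and so depends on finitely many scatterers. -/
theorem noReturn_closed (F : Finset Cell) (s : Bool) {C : Cell → Orientation}
    (hC : C ∉ noReturn F s) :
    ∃ n, ∀ C', (∀ q ∈ triangle n, C' q = C q) → C' ∉ noReturn F s := by
  simp only [noReturn, Set.mem_ofPred_eq, not_forall, not_not] at hC ⊢
  obtain ⟨t, ht⟩ := hC
  obtain ⟨n, hn⟩ := exists_subset_triangle ((Finset.range (t + 1)).image fun i =>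
    (Walker.step^[i + 1] ⟨(0, 0, s), 0, flip F C⟩).pos)
  refine ⟨n, fun C' hC' => ⟨t, ?_⟩⟩
  obtain ⟨h1, h2, -⟩ := Walker.iterate_congr (B := (triangle n : Set Cell))
    (x := ⟨(0, 0, s), 0, flip F C⟩) (y := ⟨(0, 0, s), 0, flip F C'⟩) rfl rfl
    (fun q hq => (flip_congr F (hC' q hq)).symm) (t + 1)
    (fun i hi => hn (Finset.mem_image_of_mem _ (Finset.mem_range.2 hi)))
  rwa [Walker.IsHome, h1, h2] at ht

theorem noReturn_escape (F : Finset Cell) (s : Bool) {C : Cell → Orientation}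
    (hC : C ∈ noReturn F s) (n : ℕ) :
    ∃ D : Finset Cell, D.card ≤ 17 ∧ Disjoint (triangle n) D ∧ ∃ η : Cell → Orientation,
      ∀ C', (∀ q ∈ triangle n, C' q = C q) → (∀ q ∈ D, C' q = η q) → C' ∉ noReturn F s := by
  set x : Walker := ⟨(0, 0, s), 0, flip F C⟩ with hx
  have hhome : ∀ s, (neighbour (0, 0, s) 0 = (0, 0, false) ∨
      neighbour (0, 0, s) 0 = (0, 0, true)) := by decide
  -- A trajectory confined to the triangle would be periodic and hence return home.
  have hexit : ∃ i, (Walker.step^[i + 1] x).pos ∉ triangle n := by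
    by_contra h
    push Not at h
    obtain ⟨t, ht⟩ := Walker.exists_iterate_eq_of_bounded (triangle n) h
    refine hC t ?_
    rw [ht]
    exact ⟨by cases s <;> simp [x], rfl⟩
  have hpos : x.pos ∈ triangle n := mem_triangle.2 fun l => by
    rcases zmod_three_cases l with rfl | rfl | rfl <;> cases s <;>
      simp [x, coord, zmod_three_ne]
  obtain ⟨D, hcard, hdisj, η, hη⟩ := exists_return_of_exit x hpos hexit
  -- The pattern `η` is required after the flips in `F`, so `flip F η` is prescribed before them.
  refine ⟨D, hcard, hdisj, flip F η, fun C' h1 h2 hC' => ?_⟩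
  obtain ⟨t, ht1, ht2⟩ := hη (flip F C') (fun q hq => flip_congr F (h1 q hq)) fun q hq => by
    rw [flip_congr F (h2 q hq), flip_flip]
  refine hC' t ⟨?_, ht2⟩
  change (Walker.step^[t + 1] ⟨x.pos, x.dir, flip F C'⟩).pos = _ ∨
    (Walker.step^[t + 1] ⟨x.pos, x.dir, flip F C'⟩).pos = _
  rw [ht1]
  exact hhome s

/-- A property that recurs once from each state recurs infinitely often. -/
theorem Walker.infinite_of_recurs {G : Walker → Prop}
    (hG : ∀ x, G x → ∃ t, G (Walker.step^[t + 1] x)) {x : Walker} (hx : G x) :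
    {t | G (Walker.step^[t] x)}.Infinite := by
  refine Set.infinite_of_forall_exists_gt fun N => ?_
  induction N with
  | zero =>
    obtain ⟨t, ht⟩ := hG x hx
    exact ⟨t + 1, ht, by omega⟩
  | succ N ih =>
    obtain ⟨t, ht, htN⟩ := ih
    obtain ⟨u, hu⟩ := hG _ ht
    rw [← Function.iterate_add_apply] at hu
    exact ⟨_, hu, by omega⟩

theorem infinite_returns_of_forall_notMem_noReturn {C : Cell → Orientation}
    (hC : ∀ F s, C ∉ noReturn F s) :
    {t | (Walker.step^[t] ⟨(0, 0, false), 0, C⟩).pos = (0, 0, false)}.Infinite := by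
  have hinf := Walker.infinite_of_recurs (G := fun x => x.IsHome ∧ ∃ F, x.config = flip F C)
    (x := ⟨(0, 0, false), 0, C⟩) (fun x ⟨hx, F, hF⟩ => by
      obtain ⟨s, hs⟩ : ∃ s, x = ⟨(0, 0, s), 0, flip F C⟩ := by
        rcases hx.1 with h | h
        exacts [⟨false, Walker.ext h hx.2 hF⟩, ⟨true, Walker.ext h hx.2 hF⟩]
      have h := hC F s
      simp only [noReturn, Set.mem_ofPred_eq, not_forall, not_not, ← hs] at h
      obtain ⟨t, ht⟩ := h
      exact ⟨t, ht, Walker.exists_iterate_config_eq_flip ⟨F, hF⟩ _⟩)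
    ⟨⟨Or.inl rfl, rfl⟩, ∅, by funext q; simp [flip]⟩
  refine Set.infinite_of_forall_exists_gt fun N => ?_
  obtain ⟨t, ⟨ht, -⟩, hN⟩ := hinf.exists_gt N
  rcases ht.1 with h | h
  · exact ⟨t, h, hN⟩
  -- From the other end of the home bond, the particle reaches the origin one step later.
  · refine ⟨t + 1, ?_, by omega⟩
    rw [Set.mem_ofPred_eq, Function.iterate_succ_apply']
    simp only [Walker.step, h, ht.2]
    rfl

/-! ### Bond colourings and constant initial configurations -/

/-- A proper colouring of the bonds by three colours such that, at each site, the scatterer turns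
the particle to the bond with the next colour (at `a, b, false`) or the previous one. -/
structure IsColouring (C : Cell → Orientation) (κ : Cell → ZMod 3 → ZMod 3) : Prop where
  symm : ∀ p k, κ (neighbour p k) k = κ p k
  turn_eq : ∀ p k, κ p (turn k (C p)) = κ p k + if p.2.2 then -1 else 1

theorem isColouring_const (z : Orientation) :
    IsColouring (fun _ => z) fun p k =>
      ((z : ℤ) : ZMod 3) * ((p.2.1 : ZMod 3) - p.1 + if p.2.2 then k else -k) where
  symm := by
    rintro ⟨a, b, s⟩ k
    have h3 : (3 : ZMod 3) = 0 := by decide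
    rcases zmod_three_cases k with rfl | rfl | rfl <;> cases s <;>
      simp only [neighbour, zmod_three_ne, if_true, if_false, Bool.not_true, Bool.not_false,
        Bool.false_eq_true] <;> push_cast <;>
      first
        | ring1
        | linear_combination ((z : ℤ) : ZMod 3) * h3
        | linear_combination -((z : ℤ) : ZMod 3) * h3
  turn_eq := by
    rintro ⟨a, b, s⟩ k
    rcases Int.units_eq_one_or z with rfl | rfl <;> cases s <;> simp [turn] <;> ring

theorem bijective_of_shift : ∀ (f : ZMod 3 → ZMod 3) (u e : ZMod 3), u ≠ 0 → e ≠ 0 →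
    (∀ k, f (k - u) = f k + e) → Function.Injective f ∧ ∀ c, ∃ k, f k = c := by
  decide

namespace IsColouring

variable {C : Cell → Orientation} {κ : Cell → ZMod 3 → ZMod 3}

/-- Turning shifts labels and colours by generators of `ZMod 3`, so the three bonds at a site carry
all three colours. -/
theorem injective_and_surjective (h : IsColouring C κ) (p : Cell) :
    Function.Injective (κ p) ∧ ∀ c, ∃ k, κ p k = c := by
  refine bijective_of_shift (κ p) (((C p : ℤˣ) : ℤ) : ZMod 3) (if p.2.2 then -1 else 1) ?_ ?_
    (h.turn_eq p)
  · rcases Int.units_eq_one_or (C p) with e | e <;> rw [e] <;> decide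
  · cases p.2.2 <;> decide

/-- The colour of the bond along which a particle leaves a site, if it leaves `(a, b, false)`
along bonds of colour `j`. -/
def outColour (j : ZMod 3) (p : Cell) : ZMod 3 := if p.2.2 then j - 1 else j

/-- The bond along which a particle leaves a site, if it leaves `(a, b, false)` along bonds of
colour `j`. -/
noncomputable def out (h : IsColouring C κ) (j : ZMod 3) (p : Cell) : ZMod 3 :=
  ((h.injective_and_surjective p).2 (outColour j p)).choose

theorem out_spec (h : IsColouring C κ) (j : ZMod 3) (p : Cell) :
    κ p (h.out j p) = outColour j p :=
  ((h.injective_and_surjective p).2 (outColour j p)).choose_spec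

theorem eq_out (h : IsColouring C κ) {j : ZMod 3} {p : Cell} {k : ZMod 3}
    (hk : κ p k = outColour j p) : k = h.out j p :=
  (h.injective_and_surjective p).1 (hk.trans (h.out_spec j p).symm)

/-- The next site on a chain of bonds with the colours `j` and `j - 1`. -/
noncomputable def next (h : IsColouring C κ) (j : ZMod 3) (p : Cell) : Cell :=
  neighbour p (h.out j p)

/-- The sublattice of the predecessor determines the colour of the arrival bond, and only one bond
at the site has that colour. -/
theorem next_injective (h : IsColouring C κ) (j : ZMod 3) : Function.Injective (h.next j) := by
  intro p q e
  have hs : p.2.2 = q.2.2 := by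
    have := congrArg (fun x : Cell => x.2.2) e
    simpa [next, neighbour] using this
  have hk : h.out j p = h.out j q := by
    apply (h.injective_and_surjective (h.next j p)).1
    conv_rhs => rw [e]
    simp only [next]
    rw [h.symm, h.symm, h.out_spec, h.out_spec, outColour, outColour, hs]
  have := congrArg (fun x => neighbour x (h.out j p)) e
  simp only [next] at this
  rwa [neighbour_neighbour, hk, neighbour_neighbour] at this

/-- The colour moves down by one at `true` sites and up by one at `false` sites, so an unflipped
scatterer keeps the particle on the colours `j` and `j - 1`. -/
theorem turn_out (h : IsColouring C κ) (j : ZMod 3) (p : Cell) :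
    turn (h.out j p) (C (h.next j p)) = h.out j (h.next j p) := by
  apply h.eq_out
  rw [h.turn_eq, next, h.symm, h.out_spec]
  cases hs : p.2.2 <;> simp [outColour, neighbour, hs]
  ring

/-- Until the chain closes, the particle follows it. -/
theorem iterate_step (h : IsColouring C κ) (j : ZMod 3) (p : Cell) (t : ℕ)
    (ht : ∀ a b, 0 < a → a < b → b ≤ t → (h.next j)^[a] p ≠ (h.next j)^[b] p) :
    Walker.step^[t] ⟨p, h.out j p, C⟩ = ⟨(h.next j)^[t] p, h.out j ((h.next j)^[t] p),
      flip ((Finset.range t).image fun i => (h.next j)^[i + 1] p) C⟩ := by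
  induction t with
  | zero => exact Walker.ext rfl rfl (by funext q; simp [flip])
  | succ t ih =>
    rw [Function.iterate_succ_apply', ih fun a b ha hab hb => ht a b ha hab (by omega)]
    set S := (Finset.range t).image fun i => (h.next j)^[i + 1] p with hS
    have hq : neighbour ((h.next j)^[t] p) (h.out j ((h.next j)^[t] p)) = (h.next j)^[t + 1] p := by
      rw [Function.iterate_succ_apply']; rfl
    have hmem : (h.next j)^[t + 1] p ∉ S := by
      intro hm
      obtain ⟨i, hi, e⟩ := Finset.mem_image.1 hm
      rw [Finset.mem_range] at hi
      exact ht (i + 1) (t + 1) (by omega) (by omega) le_rfl e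
    have hflip : flip S C ((h.next j)^[t + 1] p) = C ((h.next j)^[t + 1] p) := if_neg hmem
    refine Walker.ext hq ?_ ?_
    · simp only [Walker.step, hq, hflip]
      rw [Function.iterate_succ_apply']
      exact h.turn_out j _
    · simp only [Walker.step, hq, hflip]
      funext r
      rw [Finset.range_add_one, Finset.image_insert, ← hS]
      generalize (h.next j)^[t + 1] p = q
      by_cases e : r = q
      · subst e; simp [flip]
      · simp [flip, e]

/-- Interchanging the two colours on a closed chain. -/
theorem swap (h : IsColouring C κ) (j : ZMod 3) (S : Finset Cell)
    (hS : ∀ p, h.next j p ∈ S ↔ p ∈ S) :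
    IsColouring (flip S C) fun p k => if p ∈ S then 2 * j - 1 - κ p k else κ p k where
  symm := by
    have h3 : (3 : ZMod 3) = 0 := by decide
    intro p k
    rw [h.symm]
    -- The reflection `c ↦ 2 * j - 1 - c` swaps `j` and `j - 1` and fixes `j + 1`. Thus bonds of the
    -- third colour may leave `S`, while bonds of the other two join sites both in `S` or both
    -- outside.
    by_cases hk : κ p k = j + 1
    · have e : 2 * j - 1 - κ p k = κ p k := by rw [hk]; linear_combination -h3
      simp [e]
    · have hmem : neighbour p k ∈ S ↔ p ∈ S := by
        by_cases hk' : κ p k = outColour j p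
        · rw [h.eq_out hk']; exact hS p
        · have hk'' : κ (neighbour p k) k = outColour j (neighbour p k) := by
            rw [h.symm]
            have key : ∀ (c j : ZMod 3) (s : Bool), c ≠ j + 1 → c ≠ (if s then j - 1 else j) →
                c = if !s then j - 1 else j := by decide
            exact key _ _ p.2.2 hk hk'
          have := hS (neighbour p k)
          rw [next, ← h.eq_out hk'', neighbour_neighbour] at this
          exact this.symm
      simp only [hmem]
  turn_eq := by
    intro p k
    by_cases hp : p ∈ S
    · have h1 := h.turn_eq p (turn k (-C p))
      have h2 : turn (turn k (-C p)) (C p) = k := by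
        simpa using turn_turn_neg k (-C p)
      rw [h2] at h1
      simp only [flip, hp, if_true, h1]
      ring
    · simp only [flip, hp, if_false]
      exact h.turn_eq p k

end IsColouring

theorem iterate_hexagon (z : Orientation) (p : Cell) (k : ZMod 3) :
    (fun x : Cell × ZMod 3 => (neighbour x.1 x.2, turn x.2 z))^[6] (p, k) = (p, k) := by
  obtain ⟨a, b, s⟩ := p
  rcases Int.units_eq_one_or z with rfl | rfl <;>
    rcases zmod_three_cases k with rfl | rfl | rfl <;> cases s <;>
    simp [neighbour, turn, zmod_three_ne, zmod_three_arith]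

/-- If all but finitely many scatterers have the same orientation, then all chains are closed. -/
theorem IsColouring.mem_periodicPts {z : Orientation} {F : Finset Cell}
    {κ : Cell → ZMod 3 → ZMod 3} (h : IsColouring (flip F fun _ => z) κ) (j : ZMod 3) (p : Cell) :
    p ∈ Function.periodicPts (h.next j) := by
  by_contra hp
  have hinj : Function.Injective fun t => (h.next j)^[t] p := by
    have key : ∀ a b, a < b → (h.next j)^[a] p ≠ (h.next j)^[b] p := by
      intro a b hab e
      rw [show b = a + (b - a) by omega, Function.iterate_add_apply] at e
      exact hp (Function.mk_mem_periodicPts (by omega)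
        ((h.next_injective j).iterate _ e).symm)
    intro a b e
    rcases lt_trichotomy a b with hab | hab | hab
    exacts [absurd e (key a b hab), hab, absurd e.symm (key b a hab)]
  obtain ⟨N, hN⟩ := (F.finite_toSet.preimage hinj.injOn).bddAbove
  have hfar : ∀ t, N < t → (h.next j)^[t] p ∉ F := fun t ht hm => by
    have : t ≤ N := hN hm
    omega
  have hrun : ∀ i, (fun x : Cell × ZMod 3 => (neighbour x.1 x.2, turn x.2 z))^[i]
      ((h.next j)^[N] p, h.out j ((h.next j)^[N] p)) =
      ((h.next j)^[N + i] p, h.out j ((h.next j)^[N + i] p)) := by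
    intro i
    induction i with
    | zero => rfl
    | succ i ih =>
      have hf := hfar (N + (i + 1)) (by omega)
      have ht := h.turn_out j ((h.next j)^[N + i] p)
      rw [Function.iterate_succ_apply', ih]
      rw [← add_assoc, Function.iterate_succ_apply'] at hf ⊢
      simp only [flip, hf, if_false] at ht
      exact Prod.ext rfl ht
  -- Beyond the last visit to `F` the chain always turns the same way, so six steps close a hexagon,
  -- against injectivity.
  have := (hrun 6).symm.trans (iterate_hexagon z _ _)
  have e := hinj (congrArg Prod.fst this :)
  omega

/-- Recurrence when all scatterers have the same initial orientation. -/
theorem infinite_returns_of_const (z : Orientation) :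
    {t | (Walker.step^[t] ⟨(0, 0, false), 0, fun _ => z⟩).pos = (0, 0, false)}.Infinite := by
  refine Set.Infinite.mono (fun t ht => ht.1) (Walker.infinite_of_recurs
    (G := fun x => x.pos = (0, 0, false) ∧ x.dir = 0 ∧ (∃ κ, IsColouring x.config κ) ∧
      ∃ F, x.config = flip F fun _ => z) ?_
    ⟨rfl, rfl, ⟨_, isColouring_const z⟩, ∅, by funext q; simp [flip]⟩)
  rintro ⟨p, k, C⟩ ⟨hp, hk, ⟨κ, h⟩, F, hF⟩
  dsimp only at hp hk h hF
  subst hp hk hF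
  set p : Cell := (0, 0, false)
  set j := κ p 0
  have hout : h.out j p = 0 := (h.eq_out rfl).symm
  have hper := h.mem_periodicPts j p
  obtain ⟨T, hT⟩ : ∃ T, Function.minimalPeriod (h.next j) p = T + 1 :=
    Nat.exists_eq_succ_of_ne_zero (Function.minimalPeriod_pos_of_mem_periodicPts hper).ne'
  have hclose : (h.next j)^[T + 1] p = p := hT ▸ Function.iterate_minimalPeriod
  -- The start `p` is not flipped at time 0, only on closing the chain at time `T + 1`; before that,
  -- all sites reached are distinct.
  have hrun := h.iterate_step j p (T + 1) fun a b ha hab hb e => by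
    rw [show b = a + (b - a) by omega, Function.iterate_add_apply] at e
    exact Function.not_isPeriodicPt_of_pos_of_lt_minimalPeriod (n := b - a) (by omega)
      (by omega) ((h.next_injective j).iterate _ e).symm
  rw [hclose, hout] at hrun
  set S := (Finset.range (T + 1)).image fun i => (h.next j)^[i + 1] p
  have hS : ∀ q, h.next j q ∈ S ↔ q ∈ S := by
    intro q
    simp only [S, Finset.mem_image, Finset.mem_range]
    constructor
    · rintro ⟨i, hi, e⟩
      rw [Function.iterate_succ_apply'] at e
      have e := h.next_injective j e
      cases i with
      | zero => exact ⟨T, by omega, hclose.trans e⟩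
      | succ i => exact ⟨i, by omega, e⟩
    · rintro ⟨i, hi, rfl⟩
      rcases Nat.lt_or_ge i T with hi' | hi'
      · exact ⟨i + 1, by omega, Function.iterate_succ_apply' _ _ _⟩
      · obtain rfl : i = T := by omega
        exact ⟨0, by omega, by rw [hclose]; rfl⟩
  refine ⟨T, ?_⟩
  rw [hrun]
  refine ⟨rfl, rfl, ⟨_, h.swap j S hS⟩, ?_⟩
  have hex := Walker.exists_iterate_config_eq_flip (x := ⟨p, 0, flip F fun _ => z⟩)
    ⟨F, rfl⟩ (T + 1)
  rw [hrun] at hex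
  exact hex

/-! ### Transfer to the planar model -/

open MeasureTheory ProbabilityTheory

/-- The position in the plane of a site given by coordinates. -/
noncomputable def toPlane (p : Cell) : Plane :=
  (if p.2.2 then !₂[(1 : ℝ), 0] else 0) + translation p.1 p.2.1

theorem toPlane_mem (p : Cell) : toPlane p ∈ sites := by
  obtain ⟨a, b, s⟩ := p
  cases s
  · exact ⟨a, b, Or.inl (by simp [toPlane])⟩
  · exact ⟨a, b, Or.inr (by simp [toPlane])⟩

theorem toPlane_zero (p : Cell) :
    toPlane p 0 = (if p.2.2 then 1 else 0) + 3 / 2 * (p.1 + p.2.1) := by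
  cases h : p.2.2 <;> simp [toPlane, translation, h]

theorem toPlane_one (p : Cell) : toPlane p 1 = √3 / 2 * (p.1 - p.2.1) := by
  cases h : p.2.2 <;> simp [toPlane, translation, h]

theorem toPlane_injective : Function.Injective toPlane := by
  rintro ⟨a, b, s⟩ ⟨a', b', s'⟩ h
  have h0 := congrArg (fun x : Plane => x 0) h
  have h1 := congrArg (fun x : Plane => x 1) h
  simp only [toPlane_zero, toPlane_one] at h0 h1
  have h3 : √3 / 2 ≠ (0 : ℝ) := by positivity
  have e1 : a - b = a' - b' := by exact_mod_cast mul_left_cancel₀ h3 h1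
  have e0 : 2 * (if s then 1 else 0) + 3 * (a + b) = 2 * (if s' then 1 else 0) + 3 * (a' + b') := by
    have : (2 * (if s then 1 else 0) + 3 * (a + b) : ℝ) =
      2 * (if s' then 1 else 0) + 3 * (a' + b') := by linarith
    exact_mod_cast this
  cases s <;> cases s' <;> simp at e0 <;> simp <;> omega

/-- The site with given coordinates. -/
noncomputable def toSite (p : Cell) : sites := ⟨toPlane p, toPlane_mem p⟩

theorem toSite_injective : Function.Injective toSite := fun _ _ h =>
  toPlane_injective (congrArg Subtype.val h)

/-- The velocity of a particle that leaves `p` along the bond with label `k`. -/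
noncomputable def velocity (p : Cell) (k : ZMod 3) : Plane := toPlane (neighbour p k) - toPlane p

theorem rotate_velocity (z : Orientation) (p : Cell) (k : ZMod 3) :
    rotate z (velocity p k) = velocity (neighbour p k) (turn k z) := by
  have h3 : √3 * √3 = (3 : ℝ) := Real.mul_self_sqrt (by norm_num)
  obtain ⟨a, b, s⟩ := p
  rcases Int.units_eq_one_or z with rfl | rfl <;>
    rcases zmod_three_cases k with rfl | rfl | rfl <;> cases s <;>
    apply plane_ext <;>
    simp [rotate_zero, rotate_one, velocity, toPlane_zero, toPlane_one, neighbour, turn,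
      zmod_three_ne, zmod_three_arith] <;>
    first
      | ring1
      | linear_combination (1 / 4 : ℝ) * h3
      | linear_combination (-1 / 4 : ℝ) * h3

/-- The coordinates of a state. -/
def Represents (s : State) (x : Walker) : Prop :=
  s.pos = toSite x.pos ∧ s.vel = velocity x.pos x.dir ∧ s.config ∘ toSite = x.config

theorem Represents.step {s : State} {x : Walker} (h : Represents s x) :
    Represents s.step x.step := by
  obtain ⟨h1, h2, h3⟩ := h
  have hr : (⟨s.pos + s.vel, s.next_mem⟩ : sites) = toSite (neighbour x.pos x.dir) := by
    apply Subtype.ext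
    change (s.pos : Plane) + s.vel = toPlane _
    rw [h1, h2]
    exact add_sub_cancel _ _
  have hc : ∀ q, s.config (toSite q) = x.config q := congrFun h3
  refine ⟨hr, ?_, ?_⟩
  · simp only [State.step, Walker.step]
    rw [hr, hc, h2, rotate_velocity]
  · funext q
    simp only [State.step, Walker.step, Function.comp_apply]
    rw [hr]
    by_cases e : q = neighbour x.pos x.dir
    · subst e; simp [hc]
    · simp [e, hc, toSite_injective.eq_iff]

theorem represents_initialState (C : sites → Orientation) :
    Represents (initialState C) ⟨(0, 0, false), 0, C ∘ toSite⟩ := by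
  refine ⟨Subtype.ext ?_, ?_, rfl⟩ <;> apply plane_ext <;>
    simp [initialState, toSite, toPlane, velocity, neighbour, translation, zmod_three_ne]

theorem position_eq (C : sites → Orientation) (t : ℕ) :
    position C t = toPlane (Walker.step^[t] ⟨(0, 0, false), 0, C ∘ toSite⟩).pos := by
  have h : Represents ((initialState C).at t)
      (Walker.step^[t] ⟨(0, 0, false), 0, C ∘ toSite⟩) := by
    induction t with
    | zero => exact represents_initialState C
    | succ t ih =>
      rw [State.at] at ih ⊢
      rw [Function.iterate_succ_apply', Function.iterate_succ_apply']
      exact ih.step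
  rw [position, h.1]
  rfl

theorem infinite_position_eq {C : sites → Orientation}
    (h : {t | (Walker.step^[t] ⟨(0, 0, false), 0, C ∘ toSite⟩).pos = (0, 0, false)}.Infinite) :
    {t : ℕ | position C t = position C 0}.Infinite := by
  refine h.mono fun t ht => ?_
  rw [Set.mem_ofPred_eq, position_eq, position_eq]
  exact congrArg toPlane ht

theorem measure_eq_neg_one {Ω : Type*} [MeasurableSpace Ω] {P : Measure Ω}
    [IsProbabilityMeasure P] {X : Ω → Orientation} (hX : Measurable X) {p : ℝ} (hp : 0 ≤ p)
    (h : P {ω | X ω = 1} = ENNReal.ofReal p) :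
    P {ω | X ω = -1} = ENNReal.ofReal (1 - p) := by
  have e : {ω | X ω = -1} = {ω | X ω = 1}ᶜ := by
    ext ω
    rcases Int.units_eq_one_or (X ω) with h | h <;> simp [h]
  have hm : MeasurableSet {ω | X ω = 1} := hX (measurableSet_orientation {1})
  rw [e, prob_compl_eq_one_sub hm, h, ENNReal.ofReal_sub _ hp, ENNReal.ofReal_one]

theorem ae_infinite_of_forall_ae_eq {Ω : Type*} [MeasurableSpace Ω] {P : Measure Ω}
    {C : sites → Ω → Orientation} {z : Orientation} (h : ∀ h, ∀ᵐ ω ∂P, C h ω = z) :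
    ∀ᵐ ω ∂P, {t : ℕ | position (fun h => C h ω) t = position (fun h => C h ω) 0}.Infinite := by
  have hall : ∀ᵐ ω ∂P, ∀ p : Cell, C (toSite p) ω = z := ae_all_iff.2 fun p => h _
  filter_upwards [hall] with ω hω
  apply infinite_position_eq
  have : (fun h => C h ω) ∘ toSite = fun _ => z := funext hω
  rw [this]
  exact infinite_returns_of_const z

end FlippingRotator

/-- Recurrence in the flipping rotator model on the honeycomb lattice, when the initial orientations
of the scatterers are independent and each is to the right with probability `p`. -/
theorem mainTheorem9 {Ω : Type*} [MeasurableSpace Ω] (P : MeasureTheory.Measure Ω)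
    [MeasureTheory.IsProbabilityMeasure P] (p : ℝ) (hp : p ∈ Set.Icc (0 : ℝ) 1)
    (C : FlippingRotator.sites → Ω → FlippingRotator.Orientation)
    (hmeas : ∀ h, Measurable (C h)) (hindep : ProbabilityTheory.iIndepFun C P)
    (hlaw : ∀ h, P {ω | C h ω = 1} = ENNReal.ofReal p) :
    ∀ᵐ ω ∂P, {t : ℕ | FlippingRotator.position (fun h => C h ω) t =
      FlippingRotator.position (fun h => C h ω) 0}.Infinite := by
  open FlippingRotator MeasureTheory in
  have hlaw' : ∀ h, P {ω | C h ω = -1} = ENNReal.ofReal (1 - p) := fun h =>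
    measure_eq_neg_one (hmeas h) hp.1 (hlaw h)
  rcases hp.1.eq_or_lt with h0 | h0
  -- The degenerate laws are separated because the escape argument needs both orientations to have
  -- positive probability.
  · refine ae_infinite_of_forall_ae_eq (z := -1) fun h => ?_
    refine (prob_compl_eq_zero_iff (hmeas h (measurableSet_orientation {-1}))).2 ?_
    refine (hlaw' h).trans ?_
    simp [← h0]
  rcases hp.2.eq_or_lt with h1 | h1
  · refine ae_infinite_of_forall_ae_eq (z := 1) fun h => ?_
    refine (prob_compl_eq_zero_iff (hmeas h (measurableSet_orientation {1}))).2 ?_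
    refine (hlaw h).trans ?_
    simp [h1]
  have hnull : ∀ F s, ∀ᵐ ω ∂P, (fun q => C (toSite q) ω) ∉ noReturn F s := fun F s => by
    refine measure_mono_null (fun ω hω => not_not.1 hω) (measure_eq_zero_of_escape
      (X := fun q => C (toSite q)) (fun q => hmeas _) (hindep.precomp toSite_injective)
      (m := ENNReal.ofReal (min p (1 - p))) ?_ ?_ ?_ triangle_mono 17 (noReturn F s)
      (fun _ => noReturn_closed F s) (fun _ => noReturn_escape F s))
    · simpa using ⟨h0, h1⟩
    · exact ENNReal.ofReal_le_one.2 ((min_le_left _ _).trans hp.2)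
    · intro q z
      rcases Int.units_eq_one_or z with rfl | rfl
      · exact (ENNReal.ofReal_le_ofReal (min_le_left _ _)).trans (hlaw _).ge
      · exact (ENNReal.ofReal_le_ofReal (min_le_right _ _)).trans (hlaw' _).ge
  have hall : ∀ᵐ ω ∂P, ∀ F s, (fun q => C (toSite q) ω) ∉ noReturn F s :=
    ae_all_iff.2 fun F => ae_all_iff.2 fun s => hnull F s
  filter_upwards [hall] with ω hω
  exact infinite_position_eq (infinite_returns_of_forall_notMem_noReturn hω)
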